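/- Let $\rho$ be a density matrix on $\mathbb C^n$ (an $n\times n$ complex positive semidefinite matrix with trace one), with eigenvalues $\lambda_1,\dots,\lambda_n\ge 0$ counted with multiplicity. Its subentropy is $$Q(\rho)=F(\lambda_1,\dots,\lambda_n),\qquad F(\lambda)=-\sum_{i=1}^n\frac{\lambda_i^n}{\prod_{j\ne i}(\lambda_i-\lambda_j)}\,\ln\lambda_i ,$$ where, if eigenvalues coincide or vanish, $F(\lambda)$ is the limit of this expression along vectors with positive, pairwise distinct entries tending to $\lambda$. This limit exists and is finite for every density matrix $\rho$, and subentropy does not decrease under mixing-enhancing (random-unitary) maps: (a) If $(U_i)_i$ is a finite or infinite family of $n\times n$ unitary matrices and $(q_i)_i$ is a probability distribution ($q_i\ge 0$, $\sum_i q_i=1$), then $\sum_i q_iU_i\rho U_i^\dagger$ is a density matrix and $$Q\Big(\sum_i q_iU_i\rho U_i^\dagger\Big)\ \ge\ Q(\rho).$$ (b) More generally, if $(\Omega,\mu)$ is a probability space and $\omega\mapsto U_\omega$ is a measurable map from $\Omega$ to the $n\times n$ unitary matrices, then $\int_\Omega U_\omega\rho U_\omega^\dagger\,d\mu(\omega)$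 (entrywise integral) is a density matrix and $$Q\Big(\int_\Omega U_\omega\rho U_\omega^\dagger\,d\mu(\omega)\Big)\ \ge\ Q(\rho).$$ -/

import Mathlib

open Filter Topology MeasureTheory
open scoped Matrix ComplexOrder

namespace Subentropy

/-- A density matrix (state) on the Hilbert space `ℂⁿ`: positive semidefinite, of trace one. -/
structure IsDensityMatrix {n : ℕ} (ρ : Matrix (Fin n) (Fin n) ℂ) : Prop where
  posSemidef : ρ.PosSemidef
  trace_eq_one : ρ.trace = 1

/-- The expression `- ∑ i, lᵢ ^ n / ∏_{j ≠ i} (lᵢ - lⱼ) * ln lᵢ`, meaningful as it stands when the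
entries of `l` are positive and pairwise distinct. -/
noncomputable def formula {n : ℕ} (l : Fin n → ℝ) : ℝ :=
  -∑ i, l i ^ n / (∏ j ∈ Finset.univ.erase i, (l i - l j)) * Real.log (l i)

/-- The vectors at which `formula` can be taken literally: positive, pairwise distinct entries. -/
def generic (n : ℕ) : Set (Fin n → ℝ) :=
  {l | (∀ i, 0 < l i) ∧ Function.Injective l}

/-- The function `F` on vectors with nonnegative entries: the limit of `formula` along vectors with
positive, pairwise distinct entries. (Where `formula` can be taken literally it is continuous, so
the limit is its value; the limit also covers coinciding and vanishing entries.) -/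
noncomputable def F {n : ℕ} (l : Fin n → ℝ) : ℝ :=
  limUnder (𝓝[generic n] l) formula

/-- The eigenvalues of a density matrix, with multiplicity. Their order plays no role below, as
`formula` is symmetric. -/
noncomputable def eigenvalues {n : ℕ} {ρ : Matrix (Fin n) (Fin n) ℂ} (hρ : IsDensityMatrix ρ) :
    Fin n → ℝ :=
  hρ.posSemidef.isHermitian.eigenvalues

/-- The subentropy `Q(ρ)` of a density matrix `ρ`. -/
noncomputable def Q {n : ℕ} (ρ : Matrix (Fin n) (Fin n) ℂ) (hρ : IsDensityMatrix ρ) : ℝ :=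
  F (eigenvalues hρ)

end Subentropy

/-! ### Integral representation of `F`. -/

namespace Subentropy

/-! Lagrange interpolation together with `ln x = ∫₀^∞ (1/(1+s) - 1/(s+x)) ds` turns the singular
formula into `∫₀^∞ (1 - ∏ s/(s+λᵢ) - (∑ λᵢ)/(1+s)) ds`. This makes sense for all nonnegative `λ`,
and dominated convergence identifies it with the limit defining `F` (`tendsto_formula`). For a
density matrix the integrand is `1 - s^n / det(s + ρ) - 1/(1+s)`, so it suffices that mixing does
not decrease `det(s + ρ)` for each `s > 0` (`det_le_det`). That holds because `log det` is concave
and unitarily invariant. Only linear functionals of the mixture enter, so sums and integrals are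
both handled through `IsUnitaryMixture`. -/

/-- The integrand of the integral representation of `F`. -/
noncomputable def integrand {n : ℕ} (l : Fin n → ℝ) (s : ℝ) : ℝ :=
  1 - ∏ i, s / (s + l i) - (∑ i, l i) / (1 + s)

lemma degree_X_pow_sub_nodal_lt {n : ℕ} (l : Fin n → ℝ) :
    (Polynomial.X ^ n - Lagrange.nodal Finset.univ l : Polynomial ℝ).degree
      < (Finset.univ : Finset (Fin n)).card := by
  have h := Polynomial.degree_sub_lt_left (p := (Polynomial.X ^ n : Polynomial ℝ))
    (q := Lagrange.nodal Finset.univ l) (by simp [Lagrange.degree_nodal])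
    (Polynomial.monic_X_pow n).ne_zero
    (by rw [(Polynomial.monic_X_pow n).leadingCoeff, (Lagrange.nodal_monic).leadingCoeff])
  simpa using h

/-- `X^n - ∏ (X - lᵢ)` has degree below `n` and takes the values `lᵢ^n` at the nodes; the sum is
Lagrange's expression for its coefficient of `X^(n-1)`. -/
lemma sum_weight_mul_pow {n : ℕ} {l : Fin n → ℝ} (hl : Function.Injective l) :
    ∑ i, l i ^ n / (∏ j ∈ Finset.univ.erase i, (l i - l j)) = ∑ i, l i := by
  rcases n with _ | n
  · simp
  have h := Lagrange.coeff_eq_sum (s := Finset.univ) (v := l) hl.injOn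
    (degree_X_pow_sub_nodal_lt l)
  have hd : (Lagrange.nodal Finset.univ l).natDegree = n + 1 := by
    simp [Lagrange.natDegree_nodal]
  have hc : (Lagrange.nodal Finset.univ l).coeff n = -∑ i, l i := by
    have := Polynomial.prod_X_sub_C_nextCoeff (s := Finset.univ) l
    rw [Polynomial.nextCoeff_of_natDegree_pos] at this
    · rw [← this]
      change _ = (Lagrange.nodal Finset.univ l).coeff ((Lagrange.nodal Finset.univ l).natDegree - 1)
      rw [hd, Nat.add_sub_cancel]
    · change 0 < (Lagrange.nodal Finset.univ l).natDegree
      omega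
  simp only [Finset.card_univ, Fintype.card_fin, Nat.add_sub_cancel, Polynomial.coeff_sub, hc,
    Polynomial.coeff_X_pow] at h
  simpa [Lagrange.eval_nodal_at_node] using h.symm

/-- The same interpolating polynomial, evaluated at `-s` in barycentric form. -/
lemma sum_weight_mul_pow_div {n : ℕ} {l : Fin n → ℝ} (hl : l ∈ generic n) {s : ℝ} (hs : 0 < s) :
    ∑ i, l i ^ n / (∏ j ∈ Finset.univ.erase i, (l i - l j)) * (1 / (s + l i)) =
      1 - ∏ i, s / (s + l i) := by
  have hpos : ∀ i, 0 < s + l i := fun i => add_pos hs (hl.1 i)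
  have hP := Lagrange.eq_interpolate_of_eval_eq (s := Finset.univ) (v := l)
    (r := fun i => l i ^ n) hl.2.injOn (degree_X_pow_sub_nodal_lt l)
    (by intro i _; simp [Lagrange.eval_nodal_at_node])
  have h := congrArg (Polynomial.eval (-s)) hP
  rw [Lagrange.eval_interpolate_not_at_node (s := Finset.univ) _
    (fun i _ => by linarith [hpos i])] at h
  simp only [Polynomial.eval_sub, Polynomial.eval_pow, Polynomial.eval_X, Lagrange.eval_nodal] at h
  have hN : ∏ i, (-s - l i) ≠ 0 := Finset.prod_ne_zero_iff.2 fun i _ => by linarith [hpos i]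
  have hS : ∑ i, Lagrange.nodalWeight Finset.univ l i * (-s - l i)⁻¹ * l i ^ n =
      -∑ i, l i ^ n / (∏ j ∈ Finset.univ.erase i, (l i - l j)) * (1 / (s + l i)) := by
    rw [← Finset.sum_neg_distrib]
    refine Finset.sum_congr rfl fun i _ => ?_
    rw [show -s - l i = -(s + l i) by ring, Lagrange.nodalWeight, Finset.prod_inv_distrib, inv_neg]
    ring
  have hprod : ∏ i, s / (s + l i) = (-s) ^ n / ∏ i, (-s - l i) := by
    rw [show (-s) ^ n = ∏ _i : Fin n, (-s) by simp, ← Finset.prod_div_distrib]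
    refine Finset.prod_congr rfl fun i _ => ?_
    rw [show -s - l i = -(s + l i) by ring, neg_div_neg_eq]
  rw [hS] at h
  rw [hprod, eq_sub_iff_add_eq, ← eq_sub_iff_add_eq', div_eq_iff hN]
  linarith

lemma hasDerivAt_log_ratio {x : ℝ} (hx : 0 < x) {s : ℝ} (hs : 0 ≤ s) :
    HasDerivAt (fun s => Real.log (1 + s) - Real.log (s + x)) (1 / (1 + s) - 1 / (s + x)) s :=
  (((hasDerivAt_id s).const_add 1).log (by simp; linarith)).sub
    (((hasDerivAt_id s).add_const x).log (by simp; linarith))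

lemma tendsto_log_ratio (x : ℝ) :
    Tendsto (fun s => Real.log (1 + s) - Real.log (s + x)) atTop (𝓝 0) := by
  have h1 := Real.tendsto_log_comp_add_sub_log 1
  have h2 := Real.tendsto_log_comp_add_sub_log x
  have := h1.sub h2
  simp only [sub_zero] at this
  refine this.congr fun s => ?_
  rw [add_comm s 1]
  ring

lemma integrableOn_inv_sub_inv {x : ℝ} (hx : 0 < x) :
    IntegrableOn (fun s => 1 / (1 + s) - 1 / (s + x)) (Set.Ioi 0) := by
  rcases le_total 1 x with h | h
  · refine integrableOn_Ioi_deriv_of_nonneg' (fun s hs => hasDerivAt_log_ratio hx hs) ?_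
      (tendsto_log_ratio x)
    intro s hs
    have hs : 0 < s := hs
    exact sub_nonneg.2 (one_div_le_one_div_of_le (by linarith) (by linarith))
  · refine integrableOn_Ioi_deriv_of_nonpos' (fun s hs => hasDerivAt_log_ratio hx hs) ?_
      (tendsto_log_ratio x)
    intro s hs
    have hs : 0 < s := hs
    exact sub_nonpos.2 (one_div_le_one_div_of_le (by linarith) (by linarith))

lemma integral_inv_sub_inv {x : ℝ} (hx : 0 < x) :
    ∫ s in Set.Ioi 0, (1 / (1 + s) - 1 / (s + x)) = Real.log x := by
  rw [integral_Ioi_of_hasDerivAt_of_tendsto' (fun s hs => hasDerivAt_log_ratio hx hs)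
    (integrableOn_inv_sub_inv hx) (tendsto_log_ratio x)]
  simp

/-- On generic vectors `formula` has an integral representation without singularities. -/
lemma formula_eq_integral {n : ℕ} {l : Fin n → ℝ} (hl : l ∈ generic n) :
    formula l = ∫ s in Set.Ioi 0, integrand l s := by
  have h : ∀ s ∈ Set.Ioi (0 : ℝ), integrand l s =
      -∑ i, l i ^ n / (∏ j ∈ Finset.univ.erase i, (l i - l j)) *
        (1 / (1 + s) - 1 / (s + l i)) := by
    intro s hs
    simp only [mul_sub, Finset.sum_sub_distrib, ← Finset.sum_mul]
    rw [sum_weight_mul_pow hl.2, sum_weight_mul_pow_div hl hs, integrand]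
    ring
  rw [setIntegral_congr_fun measurableSet_Ioi h, integral_neg, integral_finsetSum]
  · simp only [integral_const_mul, integral_inv_sub_inv (hl.1 _), formula]
  · exact fun i _ => (integrableOn_inv_sub_inv (hl.1 i)).const_mul _

lemma one_sub_sum_le_prod {n : ℕ} {l : Fin n → ℝ} (hl : ∀ i, 0 ≤ l i) {s : ℝ} (hs : 0 < s) :
    1 - (∑ i, l i) / s ≤ ∏ i, s / (s + l i) := by
  calc 1 - (∑ i, l i) / s ≤ Real.exp (-((∑ i, l i) / s)) := by
        linarith [Real.add_one_le_exp (-((∑ i, l i) / s))]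
    _ = ∏ i, Real.exp (-(l i / s)) := by
        rw [← Real.exp_sum, Finset.sum_neg_distrib, Finset.sum_div]
    _ ≤ ∏ i, s / (s + l i) := by
        refine Finset.prod_le_prod (fun i _ => (Real.exp_pos _).le) fun i _ => ?_
        have h0 := hl i
        rw [Real.exp_neg, ← inv_div (s + l i) s]
        refine inv_anti₀ (div_pos (by linarith) hs) ?_
        calc (s + l i) / s = l i / s + 1 := by rw [add_comm, add_div, div_self hs.ne']
          _ ≤ _ := Real.add_one_le_exp _

lemma one_add_sum_le_prod {ι : Type*} (t : Finset ι) {a : ι → ℝ} (ha : ∀ i, 0 ≤ a i) :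
    1 + ∑ i ∈ t, a i ≤ ∏ i ∈ t, (1 + a i) := by
  classical
  induction t using Finset.induction_on with
  | empty => simp
  | insert i t hi ih =>
    rw [Finset.sum_insert hi, Finset.prod_insert hi]
    nlinarith [ha i, mul_nonneg (ha i) (Finset.sum_nonneg fun j (_ : j ∈ t) => ha j)]

lemma prod_le_div {n : ℕ} {l : Fin n → ℝ} (hl : ∀ i, 0 ≤ l i) {s : ℝ} (hs : 0 < s) :
    ∏ i, s / (s + l i) ≤ s / (s + ∑ i, l i) := by
  have h : 1 + ∑ i, l i / s ≤ ∏ i, (1 + l i / s) :=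
    one_add_sum_le_prod _ fun i => div_nonneg (hl i) hs.le
  have h0 : 0 ≤ ∑ i, l i := Finset.sum_nonneg fun i _ => hl i
  have e : ∀ x : ℝ, 0 ≤ x → s / (s + x) = (1 + x / s)⁻¹ := by
    intro x hx
    field_simp
  rw [e _ h0, Finset.prod_congr rfl fun i _ => e _ (hl i), Finset.prod_inv_distrib]
  refine inv_anti₀ (by positivity) ?_
  rwa [Finset.sum_div]

/-- For large `s` the product is `1 - L/s + O(s⁻²)`, and the term `L/(1+s)` cancels the
nonintegrable `L/s`. The bound depends on `l` only through `M`, so it also dominates near a given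
vector. -/
lemma abs_integrand_le {n : ℕ} {l : Fin n → ℝ} (hl : ∀ i, 0 ≤ l i) {M : ℝ} (hM : ∑ i, l i ≤ M)
    {s : ℝ} (hs : 0 < s) : ‖integrand l s‖ ≤ 2 * (1 + M + M ^ 2) * (1 + s ^ 2)⁻¹ := by
  have h1 := one_sub_sum_le_prod hl hs
  have h2 := prod_le_div hl hs
  have hp : 0 ≤ ∏ i, s / (s + l i) :=
    Finset.prod_nonneg fun i _ => div_nonneg hs.le (add_nonneg hs.le (hl i))
  have h0 : 0 ≤ ∑ i, l i := Finset.sum_nonneg fun i _ => hl i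
  rw [integrand]
  set L := ∑ i, l i
  set p := ∏ i, s / (s + l i)
  have hp1 : p ≤ 1 := h2.trans (div_le_one_of_le₀ (by linarith) (by linarith))
  have hL : 2 * (1 + L + L ^ 2) ≤ 2 * (1 + M + M ^ 2) := by nlinarith
  refine le_trans ?_ (mul_le_mul_of_nonneg_right hL (by positivity))
  rw [Real.norm_eq_abs, ← div_eq_mul_inv]
  rcases le_total s 1 with h | h
  · have a1 : L / (1 + s) ≤ L := div_le_self h0 (by linarith)
    have a2 : 0 ≤ L / (1 + s) := by positivity
    have a3 : 1 + L ≤ 2 * (1 + L + L ^ 2) / (1 + s ^ 2) := by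
      rw [le_div_iff₀ (by positivity)]
      nlinarith [mul_nonneg h0 (sub_nonneg.2 (show s ^ 2 ≤ 1 by nlinarith)), sq_nonneg L]
    rw [abs_le]
    constructor <;> linarith
  · have a1 : L / s - L / (1 + s) ≤ L / s ^ 2 := by
      rw [div_sub_div _ _ hs.ne' (by positivity), div_le_div_iff₀ (by positivity) (by positivity)]
      nlinarith [mul_nonneg h0 hs.le, mul_nonneg (mul_nonneg h0 hs.le) hs.le]
    have a2 : L / (1 + s) ≤ L / s := div_le_div_of_nonneg_left h0 hs (by linarith)
    have a3 : s / (s + L) ≤ 1 - L / s + L ^ 2 / s ^ 2 := by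
      have : 1 - L / s + L ^ 2 / s ^ 2 - s / (s + L) = L ^ 3 / (s ^ 2 * (s + L)) := by
        field_simp
        ring
      have : 0 ≤ L ^ 3 / (s ^ 2 * (s + L)) := by positivity
      linarith
    have a4 : L / s ^ 2 + L ^ 2 / s ^ 2 ≤ 2 * (1 + L + L ^ 2) / (1 + s ^ 2) := by
      rw [← add_div, div_le_div_iff₀ (by positivity) (by positivity)]
      have : 1 ≤ s ^ 2 := by nlinarith
      nlinarith [mul_nonneg (add_nonneg h0 (sq_nonneg L)) (sub_nonneg.2 this)]
    have a5 : 0 ≤ L / s ^ 2 := by positivity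
    have a6 : 0 ≤ L ^ 2 / s ^ 2 := by positivity
    rw [abs_le]
    constructor <;> linarith

lemma measurable_integrand {n : ℕ} (l : Fin n → ℝ) : Measurable (integrand l) := by
  unfold integrand
  fun_prop

lemma integrableOn_integrand {n : ℕ} {l : Fin n → ℝ} (hl : ∀ i, 0 ≤ l i) :
    IntegrableOn (integrand l) (Set.Ioi 0) :=
  ((integrable_inv_one_add_sq.const_mul _).integrableOn (s := Set.Ioi 0)).mono'
    (measurable_integrand l).aestronglyMeasurable
    ((ae_restrict_mem measurableSet_Ioi).mono fun _ hs => abs_integrand_le hl le_rfl hs)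

lemma tendsto_formula {n : ℕ} {l : Fin n → ℝ} (hl : ∀ i, 0 ≤ l i) :
    Tendsto formula (𝓝[generic n] l) (𝓝 (∫ s in Set.Ioi 0, integrand l s)) := by
  have hev : (fun m => ∫ s in Set.Ioi 0, integrand m s) =ᶠ[𝓝[generic n] l] formula := by
    filter_upwards [self_mem_nhdsWithin] with m hm
    exact (formula_eq_integral hm).symm
  refine Tendsto.congr' hev ?_
  have hsum : ∀ᶠ m in 𝓝[generic n] l, ∑ i, m i ≤ ∑ i, l i + 1 := by
    have hc : Continuous fun m : Fin n → ℝ => ∑ i, m i := by fun_prop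
    exact (hc.tendsto l).mono_left nhdsWithin_le_nhds |>.eventually_le_const (by linarith)
  refine tendsto_integral_filter_of_dominated_convergence
    (fun s => 2 * (1 + (∑ i, l i + 1) + (∑ i, l i + 1) ^ 2) * (1 + s ^ 2)⁻¹)
    (.of_forall fun m => (measurable_integrand m).aestronglyMeasurable) ?_
    (integrable_inv_one_add_sq.const_mul _).integrableOn ?_
  · filter_upwards [hsum, self_mem_nhdsWithin] with m hm hg
    filter_upwards [ae_restrict_mem measurableSet_Ioi] with s hs
    exact abs_integrand_le (fun i => (hg.1 i).le) hm hs
  · filter_upwards [ae_restrict_mem measurableSet_Ioi] with s hs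
    have hs : 0 < s := hs
    have hc : ContinuousAt (fun m : Fin n → ℝ => integrand m s) l := by
      unfold integrand
      have hi : ∀ i, s + l i ≠ 0 := fun i => by linarith [hl i]
      refine ContinuousAt.sub (continuousAt_const.sub (tendsto_finsetProd _ fun i _ => ?_))
        (by fun_prop)
      exact continuousAt_const.div (continuousAt_const.add (continuous_apply i).continuousAt) (hi i)
    exact hc.tendsto.mono_left nhdsWithin_le_nhds

/-- Every vector with nonnegative entries is a limit of generic ones. -/
lemma nhdsWithin_generic_neBot {n : ℕ} {l : Fin n → ℝ} (hl : ∀ i, 0 ≤ l i) :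
    (𝓝[generic n] l).NeBot := by
  -- The slopes `i + 1` are positive, so all entries become positive, and distinct, so each pair of
  -- entries collides for at most one `e`.
  have ht : Tendsto (fun (e : ℝ) (i : Fin n) => l i + e * ((i : ℕ) + 1)) (𝓝[>] 0) (𝓝 l) := by
    have hc : Continuous fun (e : ℝ) (i : Fin n) => l i + e * ((i : ℕ) + 1) := by fun_prop
    simpa using (hc.tendsto 0).mono_left nhdsWithin_le_nhds
  have hne : ∀ i j : Fin n, i ≠ j →
      ∀ᶠ e : ℝ in 𝓝[>] 0, l i + e * ((i : ℕ) + 1) ≠ l j + e * ((j : ℕ) + 1) := by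
    intro i j hij
    have hij' : ((i : ℕ) : ℝ) - (j : ℕ) ≠ 0 :=
      sub_ne_zero.2 fun h => hij (Fin.ext (Nat.cast_injective h))
    have hfin : ∀ᶠ e : ℝ in 𝓝[≠] 0, e ≠ (l j - l i) / ((i : ℕ) - (j : ℕ)) := by
      rcases eq_or_ne ((l j - l i) / (((i : ℕ) : ℝ) - (j : ℕ))) 0 with h | h
      · rw [h]
        exact self_mem_nhdsWithin
      · exact (eventually_ne_nhds h.symm).filter_mono nhdsWithin_le_nhds
    filter_upwards [hfin.filter_mono (nhdsWithin_mono _ fun e he => ne_of_gt he)] with e he h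
    exact he (by rw [eq_div_iff hij']; linarith)
  have hgen : ∀ᶠ e : ℝ in 𝓝[>] 0, (fun i : Fin n => l i + e * ((i : ℕ) + 1)) ∈ generic n := by
    have hall : ∀ᶠ e : ℝ in 𝓝[>] 0, ∀ i j : Fin n, i ≠ j →
        l i + e * ((i : ℕ) + 1) ≠ l j + e * ((j : ℕ) + 1) := by
      simp only [eventually_all]
      exact hne
    filter_upwards [hall, self_mem_nhdsWithin] with e he hpos
    have hpos : 0 < e := hpos
    refine ⟨fun i => add_pos_of_nonneg_of_pos (hl i) (by positivity), fun i j h => ?_⟩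
    by_contra hij
    exact he i j hij h
  exact (tendsto_nhdsWithin_iff.2 ⟨ht, hgen⟩).neBot

lemma F_eq_integral {n : ℕ} {l : Fin n → ℝ} (hl : ∀ i, 0 ≤ l i) :
    F l = ∫ s in Set.Ioi 0, integrand l s := by
  have := nhdsWithin_generic_neBot hl
  exact (tendsto_formula hl).limUnder_eq

end Subentropy

/-! ### Concavity of `log det` and unitary mixtures. -/

namespace Subentropy

open scoped MatrixOrder in
lemma posDef_eq_conjTranspose_mul_self {n : ℕ} {B : Matrix (Fin n) (Fin n) ℂ} (hB : B.PosDef) :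
    ∃ C : Matrix (Fin n) (Fin n) ℂ, IsUnit C ∧ B = Cᴴ * C := by
  obtain ⟨C, hC, h⟩ := CStarAlgebra.isStrictlyPositive_iff_eq_star_mul_self.mp
    hB.isStrictlyPositive
  exact ⟨C, hC, h⟩

lemma ofReal_re_det {n : ℕ} {M : Matrix (Fin n) (Fin n) ℂ} (hM : M.PosDef) :
    0 < M.det.re ∧ (M.det.re : ℂ) = M.det := by
  obtain ⟨h1, h2⟩ := Complex.lt_def.1 hM.det_pos
  exact ⟨h1, Complex.ext (by simp) (by simpa using h2)⟩

/-- Sum `log x ≤ x - 1` over the eigenvalues. -/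
lemma log_det_le_trace_sub {n : ℕ} {M : Matrix (Fin n) (Fin n) ℂ} (hM : M.PosDef) :
    Real.log M.det.re ≤ M.trace.re - n := by
  have hd : M.det.re = ∏ i, hM.isHermitian.eigenvalues i := by
    rw [hM.isHermitian.det_eq_prod_eigenvalues]
    exact_mod_cast Complex.ofReal_re _
  have ht : M.trace.re = ∑ i, hM.isHermitian.eigenvalues i := by
    rw [hM.isHermitian.trace_eq_sum_eigenvalues]
    exact_mod_cast Complex.ofReal_re _
  rw [hd, ht, Real.log_prod fun i _ => (hM.eigenvalues_pos i).ne']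
  calc _ ≤ ∑ i, (hM.isHermitian.eigenvalues i - 1) :=
        Finset.sum_le_sum fun i _ => Real.log_le_sub_one_of_pos (hM.eigenvalues_pos i)
    _ = _ := by simp [Finset.sum_sub_distrib]

/-- The tangent inequality of the concave function `log det` at `B`. -/
lemma log_det_sub_log_det_le {n : ℕ} {A B : Matrix (Fin n) (Fin n) ℂ} (hA : A.PosDef)
    (hB : B.PosDef) :
    Real.log A.det.re - Real.log B.det.re ≤ (B⁻¹ * A).trace.re - n := by
  -- With `B⁻¹ = Cᴴ C`, the matrix `C A Cᴴ` is positive definite, of determinant `det A / det B` and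
  -- trace `tr (B⁻¹ A)`.
  obtain ⟨C, hC, hBC⟩ := posDef_eq_conjTranspose_mul_self hB.inv
  have hM : (C * A * Cᴴ).PosDef := (Matrix.IsUnit.posDef_star_right_conjugate_iff hC).2 hA
  obtain ⟨hA0, hA1⟩ := ofReal_re_det hA
  obtain ⟨hB0, hB1⟩ := ofReal_re_det hB
  have hdet : (C * A * Cᴴ).det = ((A.det.re / B.det.re : ℝ) : ℂ) := by
    have h1 : (C * A * Cᴴ).det = (Cᴴ * C).det * A.det := by
      simp only [Matrix.det_mul]
      ring
    rw [h1, ← hBC, Matrix.det_nonsing_inv, Ring.inverse_eq_inv', Complex.ofReal_div, hA1, hB1]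
    ring
  have h := log_det_le_trace_sub hM
  rwa [hdet, Complex.ofReal_re, Real.log_div hA0.ne' hB0.ne', Matrix.trace_mul_comm,
    ← Matrix.mul_assoc, ← hBC] at h

lemma det_add_eq_prod {n : ℕ} {ρ : Matrix (Fin n) (Fin n) ℂ} (hρ : ρ.IsHermitian) (s : ℝ) :
    ((s : ℂ) • 1 + ρ).det = ((∏ i, (s + hρ.eigenvalues i) : ℝ) : ℂ) := by
  have h := Matrix.eval_charpoly ρ (-(s : ℂ))
  rw [hρ.charpoly_eq, Polynomial.eval_prod] at h
  have e : (s : ℂ) • 1 + ρ = -(Matrix.scalar (Fin n) (-(s : ℂ)) - ρ) := by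
    rw [map_neg, Matrix.scalar_apply, ← Matrix.smul_one_eq_diagonal]
    abel
  rw [e, Matrix.det_neg, ← h, Complex.ofReal_prod, ← Finset.card_univ, ← Finset.prod_const,
    ← Finset.prod_mul_distrib]
  refine Finset.prod_congr rfl fun i _ => ?_
  simp
  ring

lemma posDef_smul_one_add {n : ℕ} {ρ : Matrix (Fin n) (Fin n) ℂ} (hρ : ρ.PosSemidef) {s : ℝ}
    (hs : 0 < s) : ((s : ℂ) • 1 + ρ).PosDef :=
  (Matrix.PosDef.one.smul (by exact_mod_cast hs)).add_posSemidef hρ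

/-- `σ` lies in the closed convex hull of the unitary orbit of `ρ`, expressed through real-linear
functionals. -/
def IsUnitaryMixture {n : ℕ} (ρ σ : Matrix (Fin n) (Fin n) ℂ) : Prop :=
  ∀ (K : Matrix (Fin n) (Fin n) ℂ) (c : ℝ),
    (∀ U : Matrix.unitaryGroup (Fin n) ℂ,
      c ≤ (K * ((U : Matrix (Fin n) (Fin n) ℂ) * ρ * (U : Matrix (Fin n) (Fin n) ℂ)ᴴ)).trace.re) →
    c ≤ (K * σ).trace.re

namespace IsUnitaryMixture

variable {n : ℕ} {ρ σ : Matrix (Fin n) (Fin n) ℂ}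

lemma re_trace_eq (h : IsUnitaryMixture ρ σ) (K : Matrix (Fin n) (Fin n) ℂ) (c : ℝ)
    (hc : ∀ U : Matrix.unitaryGroup (Fin n) ℂ,
      (K * ((U : Matrix (Fin n) (Fin n) ℂ) * ρ * (U : Matrix (Fin n) (Fin n) ℂ)ᴴ)).trace.re = c) :
    (K * σ).trace.re = c := by
  refine le_antisymm ?_ (h K c fun U => (hc U).ge)
  have := h (-K) (-c) fun U => by simp [← hc U]
  simpa using this

lemma isHermitian (h : IsUnitaryMixture ρ σ) (hρ : ρ.IsHermitian) : σ.IsHermitian := by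
  -- This functional vanishes on Hermitian matrices; `z = 1` and `z = I` recover real and imaginary
  -- parts.
  have key : ∀ (a b : Fin n) (z : ℂ), (z * σ a b - star z * σ b a).re = 0 := by
    intro a b z
    have ht : ∀ M : Matrix (Fin n) (Fin n) ℂ,
        ((Matrix.single b a z - Matrix.single a b (star z)) * M).trace =
          z * M a b - star z * M b a := by
      intro M
      rw [Matrix.sub_mul, Matrix.trace_sub, Matrix.trace_single_mul, Matrix.trace_single_mul]
      simp
    rw [← ht]
    refine h.re_trace_eq _ 0 fun U => ?_
    rw [ht]
    have hU := (Matrix.isHermitian_mul_mul_conjTranspose (U : Matrix (Fin n) (Fin n) ℂ) hρ).apply a b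
    generalize (U : Matrix (Fin n) (Fin n) ℂ) * ρ * (U : Matrix (Fin n) (Fin n) ℂ)ᴴ = M at hU ⊢
    rw [← hU]
    simp
  ext a b
  rw [Matrix.conjTranspose_apply]
  have h1 := key a b 1
  have h2 := key a b Complex.I
  apply Complex.ext
  · simp at h1 ⊢
    linarith
  · simp at h2 ⊢
    linarith

/-- Testing with `K = x xᴴ` gives the quadratic form at `x`. -/
lemma posSemidef (h : IsUnitaryMixture ρ σ) (hρ : ρ.PosSemidef) : σ.PosSemidef := by
  have hσ := h.isHermitian hρ.isHermitian
  refine Matrix.PosSemidef.of_dotProduct_mulVec_nonneg hσ fun x => ?_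
  have ht : ∀ M : Matrix (Fin n) (Fin n) ℂ,
      (Matrix.vecMulVec x (star x) * M).trace = star x ⬝ᵥ M *ᵥ x := by
    intro M
    rw [Matrix.vecMulVec_mul, Matrix.trace_vecMulVec, dotProduct_comm, Matrix.dotProduct_mulVec]
  have hre : 0 ≤ (star x ⬝ᵥ σ *ᵥ x).re := by
    rw [← ht]
    refine h _ 0 fun U => ?_
    rw [ht]
    exact (hρ.mul_mul_conjTranspose_same _).re_dotProduct_nonneg x
  refine Complex.le_def.2 ⟨hre, ?_⟩
  exact (hσ.im_star_dotProduct_mulVec_self x).symm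

lemma trace_re (h : IsUnitaryMixture ρ σ) : σ.trace.re = ρ.trace.re := by
  rw [← Matrix.one_mul σ]
  refine h.re_trace_eq 1 _ fun U => ?_
  rw [Matrix.one_mul, Matrix.trace_mul_comm, ← Matrix.mul_assoc]
  have : (U : Matrix (Fin n) (Fin n) ℂ)ᴴ * U = 1 := Unitary.star_mul_self_of_mem U.2
  rw [this, Matrix.one_mul]

lemma isDensityMatrix (h : IsUnitaryMixture ρ σ) (hρ : IsDensityMatrix ρ) :
    IsDensityMatrix σ := by
  have hσ := h.posSemidef hρ.posSemidef
  refine ⟨hσ, Complex.ext (by rw [h.trace_re, hρ.trace_eq_one]) ?_⟩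
  simpa using (Complex.le_def.1 hσ.trace_nonneg).2.symm

/-- Mixing unitary conjugates does not decrease the determinant. -/
lemma det_le_det (h : IsUnitaryMixture ρ σ) (hρ : ρ.PosSemidef) {s : ℝ} (hs : 0 < s) :
    ((s : ℂ) • 1 + ρ).det.re ≤ ((s : ℂ) • 1 + σ).det.re := by
  have hA := posDef_smul_one_add hρ hs
  have hB := posDef_smul_one_add (h.posSemidef hρ) hs
  set A := (s : ℂ) • 1 + ρ with hAdef
  set B := (s : ℂ) • 1 + σ with hBdef
  have hlin : ∀ M : Matrix (Fin n) (Fin n) ℂ, (B⁻¹ * ((s : ℂ) • 1 + M)).trace.re =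
      s * B⁻¹.trace.re + (B⁻¹ * M).trace.re := by
    intro M
    simp [Matrix.mul_add, Matrix.trace_add, Matrix.trace_smul]
  -- Every conjugate `U A Uᴴ` has the determinant of `A` and obeys the tangent inequality at `B`,
  -- which is linear in it. It therefore passes to the mixture `B` itself, where the right side is
  -- `n - n = 0`.
  have hle := h B⁻¹ (Real.log A.det.re - Real.log B.det.re + n - s * B⁻¹.trace.re) fun U => by
    have hUU : (U : Matrix (Fin n) (Fin n) ℂ) * (U : Matrix (Fin n) (Fin n) ℂ)ᴴ = 1 :=
      Unitary.mul_star_self_of_mem U.2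
    have hUA : (U : Matrix (Fin n) (Fin n) ℂ) * A * (U : Matrix (Fin n) (Fin n) ℂ)ᴴ =
        (s : ℂ) • 1 + (U : Matrix (Fin n) (Fin n) ℂ) * ρ * (U : Matrix (Fin n) (Fin n) ℂ)ᴴ := by
      rw [hAdef, Matrix.mul_add, Matrix.add_mul, Matrix.mul_smul, Matrix.smul_mul, Matrix.mul_one,
        hUU]
    have hdet : ((s : ℂ) • 1 +
        (U : Matrix (Fin n) (Fin n) ℂ) * ρ * (U : Matrix (Fin n) (Fin n) ℂ)ᴴ).det = A.det := by
      rw [← hUA, Matrix.det_mul_comm, ← Matrix.mul_assoc, Matrix.det_mul, ← Matrix.det_mul_comm]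
      rw [hUU, Matrix.det_one, one_mul]
    have := log_det_sub_log_det_le
      (posDef_smul_one_add (hρ.mul_mul_conjTranspose_same (U : Matrix (Fin n) (Fin n) ℂ)) hs) hB
    rw [hdet, hlin] at this
    linarith
  have hBB : (B⁻¹ * B).trace.re = n := by
    rw [Matrix.nonsing_inv_mul _ ((Matrix.isUnit_iff_isUnit_det _).1 hB.isUnit)]
    simp
  rw [hBdef, hlin] at hBB
  rw [← Real.log_le_log_iff (ofReal_re_det hA).1 (ofReal_re_det hB).1]
  linarith

end IsUnitaryMixture

variable {n : ℕ} {ρ σ : Matrix (Fin n) (Fin n) ℂ}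

lemma eigenvalues_nonneg (hρ : IsDensityMatrix ρ) (i : Fin n) : 0 ≤ eigenvalues hρ i :=
  hρ.posSemidef.eigenvalues_nonneg i

lemma integrand_eigenvalues (hρ : IsDensityMatrix ρ) (s : ℝ) :
    integrand (eigenvalues hρ) s = 1 - s ^ n / ((s : ℂ) • 1 + ρ).det.re - 1 / (1 + s) := by
  have ht : ∑ i, eigenvalues hρ i = 1 := by
    have := hρ.posSemidef.isHermitian.trace_eq_sum_eigenvalues
    rw [hρ.trace_eq_one] at this
    change ∑ i, hρ.posSemidef.isHermitian.eigenvalues i = 1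
    simpa using (congrArg Complex.re this).symm
  rw [integrand, ht, det_add_eq_prod hρ.posSemidef.isHermitian, Complex.ofReal_re,
    Finset.prod_div_distrib, Finset.prod_const, Finset.card_univ, Fintype.card_fin, eigenvalues]

lemma Q_le_Q_of_isUnitaryMixture (hρ : IsDensityMatrix ρ) (hσ : IsDensityMatrix σ)
    (h : IsUnitaryMixture ρ σ) : Q ρ hρ ≤ Q σ hσ := by
  rw [Q, Q, F_eq_integral (eigenvalues_nonneg hρ), F_eq_integral (eigenvalues_nonneg hσ)]
  refine setIntegral_mono_on (integrableOn_integrand (eigenvalues_nonneg hρ))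
    (integrableOn_integrand (eigenvalues_nonneg hσ)) measurableSet_Ioi fun s hs => ?_
  have hs : 0 < s := hs
  rw [integrand_eigenvalues, integrand_eigenvalues]
  have := div_le_div_of_nonneg_left (pow_nonneg hs.le n)
    (ofReal_re_det (posDef_smul_one_add hρ.posSemidef hs)).1 (h.det_le_det hρ.posSemidef hs)
  linarith

end Subentropy

/-! ### Sums and integrals as unitary mixtures. -/

namespace Subentropy

variable {n : ℕ}

/-- A bound uniform in `U`, used for both summability and integrability. -/
lemma norm_unitary_conj_apply_le (U : Matrix.unitaryGroup (Fin n) ℂ)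
    (ρ : Matrix (Fin n) (Fin n) ℂ) (a b : Fin n) :
    ‖((U : Matrix (Fin n) (Fin n) ℂ) * ρ * (U : Matrix (Fin n) (Fin n) ℂ)ᴴ) a b‖ ≤
      ∑ d, ∑ c, ‖ρ c d‖ := by
  have hU := entry_norm_bound_of_unitary U.2
  rw [Matrix.mul_apply]
  refine norm_sum_le_of_le _ fun d _ => ?_
  rw [norm_mul, Matrix.conjTranspose_apply, norm_star, Matrix.mul_apply]
  refine (mul_le_of_le_one_right (norm_nonneg _) (hU b d)).trans ?_
  refine norm_sum_le_of_le _ fun c _ => ?_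
  rw [norm_mul]
  exact mul_le_of_le_one_left (norm_nonneg _) (hU a c)

lemma isUnitaryMixture_tsum {ι : Type*} (ρ : Matrix (Fin n) (Fin n) ℂ) {q : ι → ℝ}
    (U : ι → Matrix.unitaryGroup (Fin n) ℂ) (hq : ∀ i, 0 ≤ q i) (hsum : HasSum q 1) :
    IsUnitaryMixture ρ (∑' i, (q i : ℂ) •
      ((U i : Matrix (Fin n) (Fin n) ℂ) * ρ * (U i : Matrix (Fin n) (Fin n) ℂ)ᴴ)) := by
  intro K c hc
  -- Needed because `tsum` defaults to `0` on nonsummable families.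
  have hs : Summable fun i => (q i : ℂ) •
      ((U i : Matrix (Fin n) (Fin n) ℂ) * ρ * (U i : Matrix (Fin n) (Fin n) ℂ)ᴴ) := by
    refine Pi.summable.2 fun a => Pi.summable.2 fun b => ?_
    refine .of_norm_bounded (hsum.summable.mul_right (∑ d, ∑ c, ‖ρ c d‖)) fun i => ?_
    rw [Matrix.smul_apply, norm_smul, Complex.norm_real, Real.norm_of_nonneg (hq i)]
    exact mul_le_mul_of_nonneg_left (norm_unitary_conj_apply_le (U i) ρ a b) (hq i)
  let φ : Matrix (Fin n) (Fin n) ℂ →+ ℝ :=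
    Complex.reAddGroupHom.comp ((Matrix.traceAddMonoidHom (Fin n) ℂ).comp (AddMonoidHom.mulLeft K))
  have hφ : Continuous φ :=
    Complex.continuous_re.comp ((continuous_const.matrix_mul continuous_id).matrix_trace)
  have h1 := hs.hasSum.map φ hφ
  have h2 := hasSum_le (fun i => ?_) (hsum.mul_right c) h1
  · rwa [one_mul] at h2
  · have : φ ((q i : ℂ) •
        ((U i : Matrix (Fin n) (Fin n) ℂ) * ρ * (U i : Matrix (Fin n) (Fin n) ℂ)ᴴ)) =
        q i * (K * ((U i : Matrix (Fin n) (Fin n) ℂ) * ρ *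
          (U i : Matrix (Fin n) (Fin n) ℂ)ᴴ)).trace.re := by
      change (K * _).trace.re = _
      rw [Matrix.mul_smul, Matrix.trace_smul, smul_eq_mul, Complex.re_ofReal_mul]
    rw [Function.comp_apply, this]
    exact mul_le_mul_of_nonneg_left (hc (U i)) (hq i)

lemma isUnitaryMixture_integral {Ω : Type*} [MeasurableSpace Ω] (ρ : Matrix (Fin n) (Fin n) ℂ)
    (μ : Measure Ω) [IsProbabilityMeasure μ] (U : Ω → Matrix.unitaryGroup (Fin n) ℂ)
    (hU : ∀ a b, Measurable fun ω => (U ω : Matrix (Fin n) (Fin n) ℂ) a b) :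
    IsUnitaryMixture ρ (Matrix.of fun a b => ∫ ω,
      ((U ω : Matrix (Fin n) (Fin n) ℂ) * ρ * (U ω : Matrix (Fin n) (Fin n) ℂ)ᴴ) a b ∂μ) := by
  intro K c hc
  have hint : ∀ a b, Integrable (fun ω =>
      ((U ω : Matrix (Fin n) (Fin n) ℂ) * ρ * (U ω : Matrix (Fin n) (Fin n) ℂ)ᴴ) a b) μ := by
    intro a b
    refine .of_bound (C := ∑ d, ∑ c, ‖ρ c d‖) (Measurable.aestronglyMeasurable ?_)
      (.of_forall fun ω => norm_unitary_conj_apply_le (U ω) ρ a b)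
    simp only [Matrix.mul_apply, Matrix.conjTranspose_apply]
    exact Finset.measurable_sum _ fun d _ => (Finset.measurable_sum _ fun c _ =>
      (hU a c).mul_const _).mul (continuous_star.measurable.comp (hU b d))
  have htr : ∀ M : Matrix (Fin n) (Fin n) ℂ, (K * M).trace = ∑ a, ∑ b, K a b * M b a := by
    intro M
    simp only [Matrix.trace, Matrix.diag_apply, Matrix.mul_apply]
  have hint' : Integrable (fun ω => (K * ((U ω : Matrix (Fin n) (Fin n) ℂ) * ρ *
      (U ω : Matrix (Fin n) (Fin n) ℂ)ᴴ)).trace) μ := by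
    simp only [htr]
    exact integrable_finsetSum _ fun a _ => integrable_finsetSum _ fun b _ =>
      (hint b a).const_mul _
  have heq : (K * Matrix.of fun a b => ∫ ω, ((U ω : Matrix (Fin n) (Fin n) ℂ) * ρ *
      (U ω : Matrix (Fin n) (Fin n) ℂ)ᴴ) a b ∂μ).trace =
      ∫ ω, (K * ((U ω : Matrix (Fin n) (Fin n) ℂ) * ρ *
        (U ω : Matrix (Fin n) (Fin n) ℂ)ᴴ)).trace ∂μ := by
    simp only [htr]
    exact ((integral_finsetSum _ fun a _ => integrable_finsetSum _ fun b _ =>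
      (hint b a).const_mul _).trans (Finset.sum_congr rfl fun a _ =>
        (integral_finsetSum _ fun b _ => (hint b a).const_mul _).trans
          (Finset.sum_congr rfl fun b _ => integral_const_mul _ _))).symm
  rw [heq]
  have hre := Complex.reCLM.integral_comp_comm hint'
  simp only [Complex.reCLM_apply] at hre
  rw [← hre]
  calc c = ∫ _ω, c ∂μ := by simp
    _ ≤ _ := integral_mono (integrable_const c) hint'.re fun ω => hc (U ω)

end Subentropy

theorem corollary2p1 {n : ℕ} (ρ : Matrix (Fin n) (Fin n) ℂ)
    (hρ : Subentropy.IsDensityMatrix ρ) :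
    -- the limit that defines `Q ρ` exists
    Tendsto Subentropy.formula (𝓝[Subentropy.generic n] (Subentropy.eigenvalues hρ))
      (𝓝 (Subentropy.Q ρ hρ)) ∧
    -- discrete (finite or infinite) mixtures of unitaries
    (∀ {ι : Type*} (q : ι → ℝ) (U : ι → Matrix.unitaryGroup (Fin n) ℂ),
      (∀ i, 0 ≤ q i) → HasSum q 1 →
      ∃ hσ : Subentropy.IsDensityMatrix
          (∑' i, (q i : ℂ) •
            ((U i : Matrix (Fin n) (Fin n) ℂ) * ρ * (U i : Matrix (Fin n) (Fin n) ℂ)ᴴ)),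
        Subentropy.Q ρ hρ ≤ Subentropy.Q _ hσ) ∧
    -- arbitrary probability distributions of unitaries; the matrix integral is entrywise
    (∀ {Ω : Type*} [MeasurableSpace Ω] (μ : Measure Ω) [IsProbabilityMeasure μ]
      (U : Ω → Matrix.unitaryGroup (Fin n) ℂ),
      (∀ a b, Measurable fun ω => (U ω : Matrix (Fin n) (Fin n) ℂ) a b) →
      ∃ hσ : Subentropy.IsDensityMatrix
          (Matrix.of fun a b => ∫ ω,
            ((U ω : Matrix (Fin n) (Fin n) ℂ) * ρ * (U ω : Matrix (Fin n) (Fin n) ℂ)ᴴ) a b ∂μ),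
        Subentropy.Q ρ hρ ≤ Subentropy.Q _ hσ) := by
  refine ⟨?_, fun q U hq hsum => ?_, fun μ _ U hU => ?_⟩
  · have h0 := Subentropy.eigenvalues_nonneg hρ
    rw [Subentropy.Q, Subentropy.F_eq_integral h0]
    exact Subentropy.tendsto_formula h0
  · have h := Subentropy.isUnitaryMixture_tsum ρ U hq hsum
    exact ⟨h.isDensityMatrix hρ, Subentropy.Q_le_Q_of_isUnitaryMixture hρ _ h⟩
  · have h := Subentropy.isUnitaryMixture_integral ρ μ U hU
    exact ⟨h.isDensityMatrix hρ, Subentropy.Q_le_Q_of_isUnitaryMixture hρ _ h⟩
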